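/- Let $k$ be a field, $A=k[t]$, $K=k(t)$, let $v_\infty=-\deg$ be the degree valuation of $K$ with valuation ring $A_\infty$ and place $P_\infty$, and write $|a|=-v_\infty(a)$ ($|0|=-\infty$). Let $F/K$ be a finite separable extension, and let $\mathcal O_F$, $\mathcal O_{F,\infty}$ be the integral closures of $A$, $A_\infty$ in $F$. A place $P$ of $F/k$ is given by a surjective valuation $v_P:F\to\mathbb Z\cup\{\infty\}$ that vanishes on $k^*$. Let $\mathbb P_\infty(F)$ be the (finite) set of places over $P_\infty$, $e(P/P_\infty)$ the ramification index, and $(t)_\infty=\sum_{P\in\mathbb P_\infty(F)}e(P/P_\infty)P$ the pole divisor of $t$. A divisor $D=\sum_P v_P(D)P$ is a finite formal $\mathbb Z$-linear combination of places, and $\mathcal L(D)=\{a\in F^*: v_P(a)\ge -v_P(D)\text{ for all }P\}\cup\{0\}$. The ideal representation of $D$ is the pair of fractional ideals $$I=\prod_{Q\notin\mathbb P_\infty(F)}\mathfrak Q^{-v_Q(D)}\subset F\ \text{ of }\mathcal O_F,\qquad I_\infty=\prod_{P\in\mathbb P_\infty(F)}\mathfrak p^{-v_P(D)}\subset F\ \text{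 of }\mathcal O_{F,\infty},$$ where $\mathfrak Q$ and $\mathfrak p$ are the prime ideals of $\mathcal O_F$ and $\mathcal O_{F,\infty}$ determined by the places $Q$ and $P$. Put $\|z\|_D=-\min_{P\in\mathbb P_\infty(F)}\frac{v_P(z)+v_P(D)}{e(P/P_\infty)}\in\{-\infty\}\cup\mathbb Q$ for $z\in F$. For $R\in\{A,K\}$, a norm on an $R$-module $L$ is a map $\|\ \|:L\to\{-\infty\}\cup\mathbb R$ with $\|x+y\|\le\max\{\|x\|,\|y\|\}$, $\|ax\|=|a|+\|x\|$ for $a\in R$, and $\|x\|=-\infty$ if and only if $x=0$; put $(L,\|\ \|)_{\le r}=\{x\in L:\|x\|\le r\}$. A lattice is a finitely generated $A$-module $L$ with a norm such that $\dim_k (L,\|\ \|)_{\le r}<\infty$ for all $r\in\mathbb R$. A normed space is a finite-dimensional $K$-vector space $E$ with a norm that has a finitely generated $A$-submodule $L\subset E$ of full rank such that $(L,\|\ \|)$ is a lattice. A family $b_1,\dots,b_m$ in a normed space is semi-reduced if $\lceil\|\sum_i a_ib_i\|\rceil=\max_i\lceil\|a_ib_i\|\rceil$ for all $a_1,\dots,a_m\in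 K$ (with $\lceil-\infty\rceil=-\infty$). **Theorem.** Let $D$ be a divisor of $F/k$ with ideal representation $(I,I_\infty)$, and write $\|\ \|=\|\ \|_D$. 1. For every $r\in\mathbb Z$, $\mathcal L(D+r(t)_\infty)=I\cap t^rI_\infty=(I,\|\ \|)_{\le r}$. 2. $(I,\|\ \|)$ is a lattice and $(F,\|\ \|)$ is a normed space. 3. $I_\infty=(F,\|\ \|)_{\le 0}$. 4. Let $(b_1,\dots,b_n)$ be a semi-reduced $A$-basis of $I$. Then for every $r\in\mathbb Z$ the elements $b_it^{j}$ with $1\le i\le n$ and $0\le j\le r-\lceil\|b_i\|\rceil$ form a $k$-basis of $\mathcal L(D+r(t)_\infty)$, this space is finite dimensional, and $$\dim_k\mathcal L(D+r(t)_\infty)=\sum_{i:\ \lceil\|b_i\|\rceil\le r}\bigl(r-\lceil\|b_i\|\rceil+1\bigr).$$ -/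

import Mathlib

open scoped Polynomial WithZero nonZeroDivisors
open IsDedekindDomain

namespace FFLattice

/-! ### Lattices and normed spaces over `k[t]` and `k(t)` -/

section Lattices

/-- The degree function `|x| = -v_∞(x)` on `K = k(t)`, with `|0| = -∞`. -/
noncomputable def degK {k : Type*} [Field k] (x : RatFunc k) : WithBot ℝ :=
  open Classical in if x = 0 then ⊥ else ((x.intDegree : ℝ) : WithBot ℝ)

/-- Norms (length functions) with values in `{-∞} ∪ ℝ` on an `R`-module `L`,
where `R ⊆ k(t)`; used for `R = k[t]` and `R = k(t)`. -/
structure IsNorm (k R : Type*) {L : Type*} [Field k] [CommRing R] [Algebra R (RatFunc k)]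
    [AddCommGroup L] [Module R L] (N : L → WithBot ℝ) : Prop where
  add_le : ∀ x y : L, N (x + y) ≤ max (N x) (N y)
  smul : ∀ (a : R) (x : L), N (a • x) = degK (algebraMap R (RatFunc k) a) + N x
  eq_bot_iff : ∀ x : L, N x = ⊥ ↔ x = 0

/-- The `k`-vector space `L_{≤ r}` of a normed `k[t]`-module. -/
def IsNorm.sublevel {k L : Type*} [Field k] [AddCommGroup L] [Module k[X] L] [Module k L]
    [IsScalarTower k k[X] L] {N : L → WithBot ℝ} (h : IsNorm k k[X] N) (r : ℝ) :
    Submodule k L where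
  carrier := {x | N x ≤ (r : WithBot ℝ)}
  add_mem' {x y} hx hy := (h.add_le x y).trans (max_le hx hy)
  zero_mem' := by
    have : N 0 = ⊥ := (h.eq_bot_iff 0).2 rfl
    simp [this]
  smul_mem' c x hx := by
    have h1 : c • x = (Polynomial.C c) • x := by
      rw [← Polynomial.algebraMap_eq, algebraMap_smul]
    have h2 : degK (algebraMap k[X] (RatFunc k) (Polynomial.C c)) ≤ 0 := by
      unfold degK
      split_ifs with h0
      · exact bot_le
      · rw [RatFunc.algebraMap_C, RatFunc.intDegree_C]
        simp
    change N (c • x) ≤ (r : WithBot ℝ)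
    rw [h1, h.smul]
    calc _ ≤ 0 + N x := by gcongr
      _ = N x := zero_add _
      _ ≤ _ := hx

/-- `(L, N)` is a lattice over `k[t]`: `L` is finitely generated, `N` is a norm on `L`, and all the
spaces `L_{≤ r}` are finite dimensional over `k`. -/
def IsLattice (k : Type*) {L : Type*} [Field k] [AddCommGroup L] [Module k[X] L] [Module k L]
    [IsScalarTower k k[X] L] (N : L → WithBot ℝ) : Prop :=
  Module.Finite k[X] L ∧ ∃ h : IsNorm k k[X] N, ∀ r : ℝ, FiniteDimensional k (h.sublevel r)

/-- `(E, N)` is a normed space over `K = k(t)`: `E` is finite dimensional over `K`, `N` is a norm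
on `E`, and some `k[t]`-submodule of full rank is a lattice. -/
def IsNormedSpace (k : Type*) {E : Type*} [Field k] [AddCommGroup E] [Module (RatFunc k) E]
    [Module k[X] E] [Module k E] [IsScalarTower k[X] (RatFunc k) E] [IsScalarTower k k[X] E]
    (N : E → WithBot ℝ) : Prop :=
  FiniteDimensional (RatFunc k) E ∧ IsNorm k (RatFunc k) N ∧
    ∃ L : Submodule k[X] E, Submodule.span (RatFunc k) (L : Set E) = ⊤ ∧
      IsLattice k (fun x : L => N x)

/-- The ceiling on `{-∞} ∪ ℝ`, with `⌈-∞⌉ = -∞`. -/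
noncomputable def ceilBot (x : WithBot ℝ) : WithBot ℤ := x.map Int.ceil

/-- Semi-reduced families: `⌈‖∑ aᵢ bᵢ‖⌉ = max ⌈‖aᵢ bᵢ‖⌉` for all `aᵢ ∈ K = k(t)`. -/
def IsSemiReduced (k : Type*) {E ι : Type*} [Field k] [AddCommGroup E] [Module (RatFunc k) E]
    [Fintype ι] (N : E → WithBot ℝ) (b : ι → E) : Prop :=
  ∀ a : ι → RatFunc k,
    ceilBot (N (∑ i, a i • b i)) = Finset.univ.sup fun i => ceilBot (N (a i • b i))

/-- The integer `⌈‖x‖⌉` of a vector `x` of length `≠ -∞`, i.e. of a nonzero vector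
(and the dummy value `0` for `x = 0`). -/
noncomputable def ceilLength {E : Type*} (N : E → WithBot ℝ) (x : E) : ℤ :=
  (ceilBot (N x)).unbotD 0

end Lattices

/-! ### A prime ideal attached to a normalized valuation -/

section Center

variable {R F : Type*} [CommRing R] [IsDedekindDomain R] [Field F] [Algebra R F]
  [IsFractionRing R F]

/-- The prime ideal `{r ∈ R | w r < 1}` of a Dedekind domain `R` with field of fractions `F`
attached to a surjective `ℤ`-valuation `w` of `F` (written multiplicatively) with `w ≤ 1` on `R`. -/
def centerPrime (w : Valuation F ℤᵐ⁰) (hs : Function.Surjective w)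
    (hle : ∀ r : R, w (algebraMap R F r) ≤ 1) : HeightOneSpectrum R where
  asIdeal :=
    { carrier := {r | w (algebraMap R F r) < 1}
      add_mem' := fun {a b} ha hb => by
        simp only [Set.mem_ofPred_eq, map_add] at *
        exact (w.map_add _ _).trans_lt (max_lt ha hb)
      zero_mem' := by simp
      smul_mem' := fun c x hx => by
        simp only [Set.mem_ofPred_eq, smul_eq_mul, map_mul] at *
        exact (mul_le_of_le_one_left' (hle c)).trans_lt hx }
  isPrime := by
    refine Ideal.isPrime_iff.2 ⟨?_, ?_⟩
    · rw [Ideal.ne_top_iff_one]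
      change ¬ (w (algebraMap R F 1) < 1)
      simp
    · intro x y hxy
      change w (algebraMap R F x) < 1 ∨ w (algebraMap R F y) < 1
      change w (algebraMap R F (x * y)) < 1 at hxy
      by_contra! h
      have hx := le_antisymm (hle x) h.1
      have hy := le_antisymm (hle y) h.2
      simp [hx, hy] at hxy
  ne_bot := by
    intro hbot
    obtain ⟨z, hz⟩ := hs (WithZero.exp (-1))
    obtain ⟨a, b, hb, rfl⟩ := IsFractionRing.div_surjective (A := R) z
    have ha : w (algebraMap R F a) < 1 := by
      have hb0 : w (algebraMap R F b) ≠ 0 := by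
        simpa using nonZeroDivisors.ne_zero hb
      rw [map_div₀, div_eq_iff hb0] at hz
      rw [hz]
      refine (mul_le_of_le_one_right' (hle b)).trans_lt ?_
      rw [← WithZero.exp_zero, WithZero.exp_lt_exp]; norm_num
    have ha' : a ∈ (⊥ : Ideal R) := by
      rw [← hbot]; exact ha
    rw [Ideal.mem_bot] at ha'
    subst ha'
    rw [map_zero, zero_div, map_zero] at hz
    exact WithZero.exp_ne_zero hz.symm

/-- The prime ideal determined by `w` satisfies `v_𝔭 = w`. -/
theorem valuation_centerPrime (w : Valuation F ℤᵐ⁰) (hs : Function.Surjective w)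
    (hle : ∀ r : R, w (algebraMap R F r) ≤ 1) :
    (centerPrime w hs hle).valuation F = w := by
  set v := centerPrime w hs hle with hv
  have hmem : ∀ r : R, r ∈ v.asIdeal ↔ w (algebraMap R F r) < 1 := fun r => Iff.rfl
  have hle1 : ∀ z : F, v.valuation F z ≤ 1 → w z ≤ 1 := by
    intro z hz
    obtain ⟨n, ⟨d, hd⟩, h⟩ := v.exists_primeCompl_mul_eq_of_integer z hz
    have hd1 : w (algebraMap R F d) = 1 := by
      refine le_antisymm (hle d) (not_lt.1 fun h' => hd ((hmem d).2 h'))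
    have := congrArg w h
    rw [map_mul, hd1, mul_one] at this
    rw [this]; exact hle n
  have heq1 : ∀ z : F, v.valuation F z = 1 → w z = 1 := by
    intro z hz
    refine le_antisymm (hle1 z hz.le) ?_
    have h2 := hle1 z⁻¹ (by rw [map_inv₀, hz, inv_one])
    have hz0 : w z ≠ 0 := by
      rw [Valuation.ne_zero_iff]; rintro rfl; simp at hz
    rw [map_inv₀] at h2
    exact (inv_le_one₀ (zero_lt_iff.2 hz0)).1 h2
  obtain ⟨p, hp⟩ := v.valuation_exists_uniformizer' F
  change v.valuation F (algebraMap R F p) = _ at hp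
  have hp0 : algebraMap R F p ≠ 0 := by
    intro h; rw [h, map_zero] at hp; exact WithZero.exp_ne_zero hp.symm
  have hwp0 : w (algebraMap R F p) ≠ 0 := (Valuation.ne_zero_iff _).2 hp0
  have hwp1 : w (algebraMap R F p) < 1 := by
    rw [← hmem, ← v.valuation_lt_one_iff_mem (K := F)]
    change v.valuation F (algebraMap R F p) < 1
    rw [hp, ← WithZero.exp_zero, WithZero.exp_lt_exp]; norm_num
  have key : ∀ z : F, z ≠ 0 →
      w z = w (algebraMap R F p) ^ (-(WithZero.log (v.valuation F z))) := by
    intro z hz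
    have hvz : v.valuation F z ≠ 0 := (Valuation.ne_zero_iff _).2 hz
    set m := WithZero.log (v.valuation F z) with hm
    have h1 : v.valuation F (z * (algebraMap R F p) ^ m) = 1 := by
      rw [map_mul, map_zpow₀, hp, ← WithZero.exp_zsmul, ← WithZero.exp_log hvz, ← hm,
        ← WithZero.exp_add]
      simp
    have h2 := heq1 _ h1
    rw [map_mul, map_zpow₀] at h2
    rw [zpow_neg]
    exact eq_inv_of_mul_eq_one_left h2
  -- surjectivity normalizes the value of the uniformizer
  have hwp : w (algebraMap R F p) = WithZero.exp (-1) := by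
    obtain ⟨z, hz⟩ := hs (WithZero.exp (-1))
    have hz0 : z ≠ 0 := by
      rintro rfl; rw [map_zero] at hz; exact WithZero.exp_ne_zero hz.symm
    have h := key z hz0
    rw [hz] at h
    rw [← WithZero.exp_log hwp0] at h hwp1 ⊢
    set l := WithZero.log (w (algebraMap R F p))
    rw [← WithZero.exp_zsmul, WithZero.exp_inj, smul_eq_mul] at h
    rw [← WithZero.exp_zero, WithZero.exp_lt_exp] at hwp1
    rw [WithZero.exp_inj]
    have hd : l ∣ 1 := ⟨WithZero.log (v.valuation F z), by linarith⟩
    have := Int.isUnit_iff.1 (isUnit_of_dvd_one hd)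
    omega
  ext z
  rcases eq_or_ne z 0 with rfl | hz
  · simp
  · have hvz : v.valuation F z ≠ 0 := (Valuation.ne_zero_iff _).2 hz
    rw [key z hz, hwp, ← WithZero.exp_zsmul]
    simp [WithZero.exp_log hvz]

theorem val_le_one_of_isIntegral {A F : Type*} [CommRing A] [Field F] [Algebra A F]
    (w : Valuation F ℤᵐ⁰) (h : ∀ a : A, w (algebraMap A F a) ≤ 1) {z : F}
    (hz : IsIntegral A z) : w z ≤ 1 := by
  obtain ⟨p, hp, hpz⟩ := hz
  let f : A →+* w.integer := (algebraMap A F).codRestrict w.integer h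
  refine (Valuation.integer.integers w).isIntegral_iff_v_le_one.1 ⟨p.map f, hp.map f, ?_⟩
  rw [Polynomial.eval₂_map]
  exact hpz

end Center

/-! ### Function fields, places, divisors -/

section FunctionFields

/-- The valuation `v_∞` of `k(t)` (written multiplicatively: `f ↦ exp (deg f)`). -/
noncomputable def vInf (k : Type*) [Field k] : Valuation (RatFunc k) ℤᵐ⁰ :=
  open Classical in RatFunc.inftyValuation k

/-- The valuation ring `A_∞` of `v_∞`. -/
noncomputable abbrev AInf (k : Type*) [Field k] : ValuationSubring (RatFunc k) := (vInf k).valuationSubring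

instance (k : Type*) [Field k] : IsDedekindDomain (AInf k) := by
  have : (vInf k).IsNontrivial := by
    classical
    exact inferInstanceAs (RatFunc.inftyValuation k).IsNontrivial
  infer_instance

variable (k F : Type*) [Field k] [Field F]

/-- The integral closure `O_{F,∞}` of `A_∞` in `F`. -/
noncomputable abbrev OInf [Algebra (RatFunc k) F] : Subalgebra (AInf k) F := integralClosure (AInf k) F

instance [Algebra (RatFunc k) F] [FunctionField k F] : IsFractionRing (OInf k F) F :=
  integralClosure.isFractionRing_of_finite_extension (RatFunc k) F

instance [Algebra (RatFunc k) F] [FunctionField k F] [Algebra.IsSeparable (RatFunc k) F] :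
    IsDedekindDomain (OInf k F) :=
  IsIntegralClosure.isDedekindDomain (AInf k) (RatFunc k) F _

/-- A place of `F/k`, given by its surjective valuation `v_P : F → ℤ ∪ {∞}`, which vanishes on
`k^*`; the valuation is written multiplicatively, `val z = exp (-v_P(z))` and `val 0 = 0`. -/
@[ext]
structure Place [Algebra k F] where
  val : Valuation F ℤᵐ⁰
  surjective : Function.Surjective val
  trivial : ∀ c : k, c ≠ 0 → val (algebraMap k F c) = 1

variable {k F}

/-- The integer `v_P(z)` for `z ≠ 0` (and the dummy value `0` for `z = 0`). -/
noncomputable def Place.ord [Algebra k F] (P : Place k F) (z : F) : ℤ := -WithZero.log (P.val z)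

theorem Place.val_eq_exp [Algebra k F] (P : Place k F) {z : F} (hz : z ≠ 0) :
    P.val z = WithZero.exp (-P.ord z) := by
  rw [Place.ord, neg_neg, WithZero.exp_log ((Valuation.ne_zero_iff _).2 hz)]

section Infinite

variable [Algebra k F] [Algebra (RatFunc k) F]

/-- `P` lies over `P_∞`, i.e. the maximal ideal of `P` meets `k(t)` in that of `v_∞`. -/
def Place.IsInfinite (P : Place k F) : Prop :=
  ∀ x : RatFunc k, P.val (algebraMap (RatFunc k) F x) < 1 ↔ vInf k x < 1

/-- The ramification index `e(P/P_∞)` of a place over `P_∞`: the value under `v_P` of the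
uniformizer `1/t` of `P_∞`. -/
noncomputable def Place.ramificationIdx (P : Place k F) : ℤ :=
  P.ord (algebraMap (RatFunc k) F (RatFunc.X)⁻¹)

theorem Place.val_AInf_le (P : Place k F) (h : P.IsInfinite) (x : AInf k) :
    P.val (algebraMap (AInf k) F x) ≤ 1 := by
  have hx : vInf k (x : RatFunc k) ≤ 1 := x.2
  change P.val (algebraMap (RatFunc k) F (x : RatFunc k)) ≤ 1
  by_contra! hlt
  have h0 : P.val (algebraMap (RatFunc k) F (x : RatFunc k)) ≠ 0 := (zero_lt_one.trans hlt).ne'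
  have hx0 : (x : RatFunc k) ≠ 0 := by
    intro h1; rw [h1] at h0; simp at h0
  have h1 := (h (x : RatFunc k)⁻¹).1 (by
    rw [map_inv₀, map_inv₀]; exact (inv_lt_one₀ (zero_lt_iff.2 h0)).2 hlt)
  rw [map_inv₀, inv_lt_one₀ (zero_lt_iff.2 ((Valuation.ne_zero_iff _).2 hx0))] at h1
  exact absurd h1 (not_lt.2 hx)

theorem Place.val_OInf_le (P : Place k F) (h : P.IsInfinite) (x : OInf k F) :
    P.val (algebraMap (OInf k F) F x) ≤ 1 :=
  val_le_one_of_isIntegral P.val (P.val_AInf_le h) x.2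

variable [FunctionField k F] [Algebra.IsSeparable (RatFunc k) F]

/-- The prime ideal of `O_{F,∞}` determined by a place over `P_∞`. -/
noncomputable def Place.infPrime (P : Place k F) (h : P.IsInfinite) :
    HeightOneSpectrum (OInf k F) :=
  centerPrime P.val P.surjective (P.val_OInf_le h)

variable (k F) in
theorem finite_isInfinite : {P : Place k F | P.IsInfinite}.Finite := by
  let M : Ideal (AInf k) := IsLocalRing.maximalIdeal (AInf k)
  have : Module.IsTorsionFree (AInf k) F := .trans_faithfulSMul (AInf k) (RatFunc k) F
  have : Module.IsTorsionFree (AInf k) (OInf k F) :=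
    Function.Injective.moduleIsTorsionFree (Subtype.val : OInf k F → F) Subtype.val_injective
      (fun _ _ => rfl)
  have hfin := IsDedekindDomain.primesOver_finite M (OInf k F)
  have hmem : ∀ P : {P : Place k F | P.IsInfinite},
      (P.1.infPrime P.2).asIdeal ∈ M.primesOver (OInf k F) := by
    intro P
    refine ⟨(P.1.infPrime P.2).isPrime, ⟨?_⟩⟩
    have hmax : (P.1.infPrime P.2).asIdeal.IsMaximal := (P.1.infPrime P.2).isMaximal
    exact (IsLocalRing.eq_maximalIdeal
      (Ideal.isMaximal_comap_of_isIntegral_of_isMaximal (R := AInf k)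
        (P.1.infPrime P.2).asIdeal)).symm
  have : Finite (M.primesOver (OInf k F)) := hfin
  refine Finite.of_injective (β := M.primesOver (OInf k F)) (fun P => ⟨_, hmem P⟩) ?_
  intro P Q hPQ
  have h1 : P.1.infPrime P.2 = Q.1.infPrime Q.2 :=
    HeightOneSpectrum.ext (congrArg Subtype.val hPQ)
  apply Subtype.ext
  apply Place.ext
  rw [← valuation_centerPrime P.1.val P.1.surjective (P.1.val_OInf_le P.2),
    ← valuation_centerPrime Q.1.val Q.1.surjective (Q.1.val_OInf_le Q.2)]
  exact congrArg (HeightOneSpectrum.valuation F) h1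

variable (k F) in
/-- The finite set `ℙ_∞(F)` of places over `P_∞`. -/
noncomputable def infinitePlaces : Finset (Place k F) := (finite_isInfinite k F).toFinset

end Infinite

section Finite

variable [Algebra k F] [Algebra k[X] F] [Algebra (RatFunc k) F]
  [IsScalarTower k[X] (RatFunc k) F] [IsScalarTower k k[X] F]

theorem algebraMap_C_eq (c : k) :
    algebraMap (RatFunc k) F (algebraMap k (RatFunc k) c) = algebraMap k F c := by
  rw [IsScalarTower.algebraMap_apply k k[X] F, IsScalarTower.algebraMap_apply k[X] (RatFunc k) F,
    ← IsScalarTower.algebraMap_apply k k[X] (RatFunc k)]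

theorem Place.isTrivialOn (P : Place k F) :
    (P.val.comap (algebraMap (RatFunc k) F)).IsTrivialOn k :=
  ⟨fun c hc => by
    rw [Valuation.comap_apply, algebraMap_C_eq, P.trivial c hc]⟩

/-- A place lies over `P_∞` iff it is a pole of `t`. -/
theorem Place.isInfinite_iff (P : Place k F) :
    P.IsInfinite ↔ 1 < P.val (algebraMap (RatFunc k) F RatFunc.X) := by
  constructor
  · intro h
    have h1 := (h (RatFunc.X)⁻¹).2 (by
      classical
      have : vInf k = RatFunc.inftyValuation k := by unfold vInf; congr
      rw [this, map_inv₀, RatFunc.inftyValuation.X, ← WithZero.exp_neg, ← WithZero.exp_zero,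
        WithZero.exp_lt_exp]
      norm_num)
    have h0 : P.val (algebraMap (RatFunc k) F RatFunc.X) ≠ 0 := by
      simp [RatFunc.X_ne_zero]
    rw [map_inv₀, map_inv₀] at h1
    exact (inv_lt_one₀ (zero_lt_iff.2 h0)).1 h1
  · intro h x
    classical
    have := P.isTrivialOn
    have h2 := RatFunc.valuation_isEquiv_inftyValuation_of_one_lt_valuation_X
      (v := P.val.comap (algebraMap (RatFunc k) F)) h
    have h3 : vInf k = RatFunc.inftyValuation k := by unfold vInf; congr
    rw [h3]
    exact Valuation.isEquiv_iff_val_lt_one.1 h2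

/-- The defining property of the ramification index: `v_P(x) = e(P/P_∞) v_∞(x)` on `k(t)`. -/
theorem Place.ord_algebraMap (P : Place k F) (h : P.IsInfinite) (x : RatFunc k) :
    P.ord (algebraMap (RatFunc k) F x) = P.ramificationIdx * (-x.intDegree) := by
  rcases eq_or_ne x 0 with rfl | hx
  · simp [Place.ord]
  have := P.isTrivialOn
  have h1 := RatFunc.valuation_eq_valuation_X_zpow_intDegree_of_one_lt_valuation_X
      (v := P.val.comap (algebraMap (RatFunc k) F)) (P.isInfinite_iff.1 h) hx
  simp only [Valuation.comap_apply] at h1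
  rw [Place.ramificationIdx, Place.ord, Place.ord, h1, map_inv₀, map_inv₀, WithZero.log_zpow,
    WithZero.log_inv]
  simp [mul_comm]

theorem Place.ramificationIdx_pos (P : Place k F) (h : P.IsInfinite) : 0 < P.ramificationIdx := by
  have h1 := P.isInfinite_iff.1 h
  rw [Place.ramificationIdx, Place.ord, map_inv₀, map_inv₀, WithZero.log_inv, neg_neg]
  rw [← WithZero.log_one]
  exact (WithZero.log_lt_log one_ne_zero (zero_lt_one.trans h1).ne').2 h1

theorem Place.val_poly_le (P : Place k F) (h : ¬ P.IsInfinite) (p : k[X]) :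
    P.val (algebraMap k[X] F p) ≤ 1 := by
  rw [P.isInfinite_iff, not_lt] at h
  have := P.isTrivialOn
  rw [IsScalarTower.algebraMap_apply k[X] (RatFunc k) F]
  exact Polynomial.valuation_le_one_of_valuation_X_le_one k
    (v := P.val.comap (algebraMap (RatFunc k) F)) h p

theorem Place.val_OFin_le (P : Place k F) (h : ¬ P.IsInfinite)
    (x : FunctionField.ringOfIntegers k F) :
    P.val (algebraMap (FunctionField.ringOfIntegers k F) F x) ≤ 1 :=
  val_le_one_of_isIntegral P.val (P.val_poly_le h) x.2

variable [FunctionField k F] [Algebra.IsSeparable (RatFunc k) F]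

/-- The prime ideal of `O_F` determined by a place which does not lie over `P_∞`. -/
noncomputable def Place.finPrime (P : Place k F) (h : ¬ P.IsInfinite) :
    HeightOneSpectrum (FunctionField.ringOfIntegers k F) :=
  centerPrime P.val P.surjective (P.val_OFin_le h)

end Finite

section Divisors

variable (k F) in
/-- Divisors of `F/k`: finite formal `ℤ`-linear combinations of places. -/
abbrev Divisor [Algebra k F] := Place k F →₀ ℤ

/-- The Riemann-Roch space `L(D) = {a ∈ F^* | (a) ≥ -D} ∪ {0}`. -/
noncomputable def RRSpace [Algebra k F] (D : Divisor k F) : Submodule k F where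
  carrier := {a | a = 0 ∨ ∀ P : Place k F, -D P ≤ P.ord a}
  add_mem' := by
    intro a b ha hb
    by_cases hab : a + b = 0
    · exact Or.inl hab
    rcases eq_or_ne a 0 with rfl | ha0
    · simpa using hb
    rcases eq_or_ne b 0 with rfl | hb0
    · simpa using ha
    refine Or.inr fun P => ?_
    have h1 := ha.resolve_left ha0 P
    have h2 := hb.resolve_left hb0 P
    have h3 := P.val.map_add a b
    rw [P.val_eq_exp hab, P.val_eq_exp ha0, P.val_eq_exp hb0, le_max_iff, WithZero.exp_le_exp,
      WithZero.exp_le_exp] at h3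
    omega
  zero_mem' := Or.inl rfl
  smul_mem' := by
    intro c a ha
    rcases eq_or_ne c 0 with rfl | hc
    · left; simp
    rcases ha with rfl | ha
    · left; simp
    refine Or.inr fun P => ?_
    rw [Algebra.smul_def, Place.ord, map_mul, P.trivial c hc, one_mul]
    exact ha P

variable [Algebra k F] [Algebra k[X] F] [Algebra (RatFunc k) F]
  [IsScalarTower k[X] (RatFunc k) F] [IsScalarTower k k[X] F]
  [FunctionField k F] [Algebra.IsSeparable (RatFunc k) F]

variable (k F) in
/-- The pole divisor `(t)_∞ = ∑ max(0, -v_P(t)) P`. -/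
noncomputable def poleDivisor : Divisor k F :=
  Finsupp.onFinset (infinitePlaces k F)
    (fun P => max 0 (-P.ord (algebraMap (RatFunc k) F RatFunc.X))) (by
      intro P hP
      rw [infinitePlaces, Set.Finite.mem_toFinset]
      change P.IsInfinite
      rw [P.isInfinite_iff]
      have h0 : P.val (algebraMap (RatFunc k) F RatFunc.X) ≠ 0 := by
        simp [RatFunc.X_ne_zero]
      rw [← WithZero.log_lt_log one_ne_zero h0, WithZero.log_one]
      rw [Place.ord, neg_neg] at hP
      by_contra! h
      exact hP (max_eq_left h))

/-- The first component `I = ∏_{Q finite} 𝔔^{-v_Q(D)}` of the ideal representation of `D`,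
a fractional ideal of `O_F`. -/
noncomputable def finIdeal (D : Divisor k F) :
    FractionalIdeal (FunctionField.ringOfIntegers k F)⁰ F :=
  open Classical in
  ∏ P ∈ D.support, if h : P.IsInfinite then 1 else
    ((P.finPrime h).asIdeal : FractionalIdeal (FunctionField.ringOfIntegers k F)⁰ F) ^ (-D P)

/-- The second component `I_∞ = ∏_{P | P_∞} 𝔭^{-v_P(D)}` of the ideal representation of `D`,
a fractional ideal of `O_{F,∞}`. -/
noncomputable def infIdeal (D : Divisor k F) : FractionalIdeal (OInf k F)⁰ F :=
  open Classical in
  ∏ P ∈ D.support, if h : P.IsInfinite then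
    ((P.infPrime h).asIdeal : FractionalIdeal (OInf k F)⁰ F) ^ (-D P) else 1

/-- The ideal `I` of the ideal representation of `D`, as a `k[t]`-submodule of `F`. -/
noncomputable def finModule (D : Divisor k F) : Submodule k[X] F :=
  ((finIdeal D : Submodule (FunctionField.ringOfIntegers k F) F)).restrictScalars k[X]

/-- The norm `‖z‖_D = -min_{P | P_∞} (v_P(z) + v_P(D)) / e(P/P_∞)`, i.e. the maximum over
`P | P_∞` of the negatives of these quotients, with `‖0‖_D = -∞` (as `v_P(0) = ∞`). -/
noncomputable def divNorm (D : Divisor k F) (z : F) : WithBot ℝ :=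
  open Classical in
  if z = 0 then ⊥ else
    (infinitePlaces k F).sup fun P =>
      ((-(((P.ord z : ℝ) + (D P : ℝ)) / (P.ramificationIdx : ℝ)) : ℝ) : WithBot ℝ)

end Divisors

end FunctionFields

end FFLattice

/-! Both ideals encode one inequality per place. Places not over `P_∞` correspond to the nonzero
primes of `O_F`, places over `P_∞` to those of `O_{F,∞}`, with the same valuations, and membership
in a fractional ideal of a Dedekind domain is tested prime by prime. So `I` records the conditions
v_P(z) ≥ -v_P(D) at the finite places (`mem_finIdeal_iff`), and `I_∞` those at the infinite ones
(`mem_infIdeal_iff`), which say ‖z‖_D ≤ 0. As v_P = e·v_∞ on k(t), multiplying by t^r shifts the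
norm by r, while adding r(t)_∞ relaxes exactly the infinite conditions by re.

Finiteness comes from coordinates over k(t): on I ∩ t^r I_∞ their denominators are bounded because I
is finitely generated over k[t], and their degrees because I_∞ is finitely generated over A_∞
(`exists_coordinate_space`).

For integral r, a semi-reduced basis turns ‖∑ pᵢbᵢ‖ ≤ r into separate bounds deg pᵢ ≤ r - ⌈‖bᵢ‖⌉
(`IsSemiReduced.le_iff`). The Riemann-Roch space is then spanned by part of the k-basis bᵢtʲ of I,
and its dimension is a count of exponents. -/

namespace FFLattice

/-! ### Fractional ideals of a Dedekind domain, prime by prime -/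

section Dedekind

variable {R F : Type*} [CommRing R] [IsDedekindDomain R] [Field F] [Algebra R F]
  [IsFractionRing R F]

theorem count_spanSingleton (v : HeightOneSpectrum R) {z : F} (hz : z ≠ 0) :
    FractionalIdeal.count F v (FractionalIdeal.spanSingleton R⁰ z) =
      -WithZero.log (v.valuation F z) := by
  obtain ⟨a, b, hb, rfl⟩ := IsFractionRing.div_surjective (A := R) z
  have hb0 : b ≠ 0 := nonZeroDivisors.ne_zero hb
  have ha0 : a ≠ 0 := by rintro rfl; simp at hz
  have hI : FractionalIdeal.spanSingleton R⁰ (algebraMap R F a / algebraMap R F b) ≠ 0 :=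
    FractionalIdeal.spanSingleton_ne_zero_iff.2 hz
  rw [FractionalIdeal.count_well_defined F v hI (a := b) (J := Ideal.span {a})]
  · rw [map_div₀, v.valuation_of_algebraMap, v.valuation_of_algebraMap,
      WithZero.log_div (v.intValuation_ne_zero _ ha0) (v.intValuation_ne_zero _ hb0),
      v.intValuation_if_neg ha0, v.intValuation_if_neg hb0, WithZero.log_exp, WithZero.log_exp]
    ring
  · rw [FractionalIdeal.coeIdeal_span_singleton, FractionalIdeal.spanSingleton_mul_spanSingleton]
    congr 1
    field_simp

theorem le_one_of_count_nonneg {J : FractionalIdeal R⁰ F} (hJ : J ≠ 0)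
    (h : ∀ v : HeightOneSpectrum R, 0 ≤ FractionalIdeal.count F v J) : J ≤ 1 := by
  rw [← FractionalIdeal.finprod_heightOneSpectrum_factorization' F hJ]
  refine finprod_induction (fun I : FractionalIdeal R⁰ F => I ≤ 1) le_rfl
    (fun I I' hI hI' => mul_le_one' hI hI') fun v => ?_
  obtain ⟨n, hn⟩ := Int.eq_ofNat_of_zero_le (h v)
  rw [hn, zpow_natCast, ← FractionalIdeal.coeIdeal_pow]
  exact FractionalIdeal.coeIdeal_le_one

/-- Containment is divisibility: z lies in J when (z)J⁻¹ is integral, that is, when none of its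
exponents is negative. -/
theorem mem_fractionalIdeal_iff {J : FractionalIdeal R⁰ F} (hJ : J ≠ 0) {z : F} (hz : z ≠ 0) :
    z ∈ J ↔ ∀ v : HeightOneSpectrum R,
      FractionalIdeal.count F v J ≤ -WithZero.log (v.valuation F z) := by
  have hz' : FractionalIdeal.spanSingleton R⁰ z ≠ 0 :=
    FractionalIdeal.spanSingleton_ne_zero_iff.2 hz
  rw [← FractionalIdeal.spanSingleton_le_iff_mem]
  constructor
  · intro h v
    rw [← count_spanSingleton v hz]
    exact FractionalIdeal.count_mono F v hz' h
  · intro h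
    have h1 : FractionalIdeal.spanSingleton R⁰ z * J⁻¹ ≤ 1 := by
      refine le_one_of_count_nonneg (mul_ne_zero hz' (inv_ne_zero hJ)) fun v => ?_
      rw [FractionalIdeal.count_mul F v hz' (inv_ne_zero hJ), FractionalIdeal.count_inv,
        count_spanSingleton v hz]
      linarith [h v]
    calc _ = FractionalIdeal.spanSingleton R⁰ z * J⁻¹ * J := by
          rw [mul_assoc, inv_mul_cancel₀ hJ, mul_one]
      _ ≤ 1 * J := by gcongr
      _ = J := one_mul J

variable {ι : Type*} {s : Finset ι} {p : ι → Prop} [DecidablePred p]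
  (g : ∀ i, p i → HeightOneSpectrum R) (m : ι → ℤ)

theorem prod_primes_ne_zero :
    (∏ i ∈ s, if h : p i then ((g i h).asIdeal : FractionalIdeal R⁰ F) ^ m i else 1) ≠ 0 := by
  refine Finset.prod_ne_zero_iff.2 fun i _ => ?_
  split_ifs with h
  · exact zpow_ne_zero _ (FractionalIdeal.coeIdeal_ne_zero.2 (g i h).ne_bot)
  · exact one_ne_zero

theorem count_prod_primes (hg : ∀ i j hi hj, g i hi = g j hj → i = j) {i : ι} (hi : p i)
    (hm : i ∉ s → m i = 0) :
    FractionalIdeal.count F (g i hi)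
      (∏ j ∈ s, if h : p j then ((g j h).asIdeal : FractionalIdeal R⁰ F) ^ m j else 1) = m i := by
  classical
  rw [FractionalIdeal.count_prod]
  · rw [Finset.sum_eq_single i]
    · rw [dif_pos hi, FractionalIdeal.count_zpow_self]
    · intro j _ hji
      split_ifs with hj
      · rw [FractionalIdeal.count_zpow, FractionalIdeal.count_maximal_coprime, mul_zero]
        exact fun h => hji (hg _ _ _ _ h)
      · exact FractionalIdeal.count_one F _
    · intro his
      rw [dif_pos hi, FractionalIdeal.count_zpow_self, hm his]
  · intro j _
    split_ifs with h
    · exact zpow_ne_zero _ (FractionalIdeal.coeIdeal_ne_zero.2 (g j h).ne_bot)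
    · exact one_ne_zero

/-- Common to both components of the ideal representation. The indices satisfying `p` must reach
every prime, since also outside `s` the exponent 0 imposes a condition on z. -/
theorem mem_prod_primes_iff (hg : ∀ i j hi hj, g i hi = g j hj → i = j)
    (hs : ∀ v : HeightOneSpectrum R, ∃ i hi, g i hi = v) (hm : ∀ i ∉ s, m i = 0) {z : F}
    (hz : z ≠ 0) :
    z ∈ (∏ j ∈ s, if h : p j then ((g j h).asIdeal : FractionalIdeal R⁰ F) ^ m j else 1) ↔
      ∀ i hi, m i ≤ -WithZero.log ((g i hi).valuation F z) := by
  rw [mem_fractionalIdeal_iff (prod_primes_ne_zero g m) hz]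
  constructor
  · intro h i hi
    rw [← count_prod_primes (F := F) g m hg hi (hm i)]
    exact h _
  · intro h v
    obtain ⟨i, hi, rfl⟩ := hs v
    rw [count_prod_primes g m hg hi (hm i)]
    exact h i hi

end Dedekind

/-! ### Places as primes of the two integral closures -/

section FunctionFields

variable {k F : Type*} [Field k] [Field F]
variable [Algebra k F] [Algebra k[X] F] [Algebra (RatFunc k) F]
  [IsScalarTower k k[X] F] [IsScalarTower k[X] (RatFunc k) F]

/-- The place attached to a prime of a Dedekind domain containing the constants. -/
noncomputable def placeOfPrime {R : Type*} [CommRing R] [IsDedekindDomain R] [Algebra R F]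
    [IsFractionRing R F] (hk : ∀ c : k, ∃ r : R, algebraMap R F r = algebraMap k F c)
    (v : HeightOneSpectrum R) : Place k F where
  val := v.valuation F
  surjective := v.valuation_surjective F
  trivial c hc := by
    obtain ⟨r, hr⟩ := hk c
    obtain ⟨r', hr'⟩ := hk c⁻¹
    -- Both c and c⁻¹ come from `R`, so each has value at most 1.
    refine le_antisymm (hr ▸ v.valuation_le_one r) ?_
    have h : v.valuation F (algebraMap R F r') ≤ 1 := v.valuation_le_one r'
    rw [hr', map_inv₀, map_inv₀] at h
    refine (inv_le_one₀ (zero_lt_iff.2 ((Valuation.ne_zero_iff _).2 ?_))).1 h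
    simpa using hc

theorem eq_of_valuation_eq {R : Type*} [CommRing R] [IsDedekindDomain R] [Algebra R F]
    [IsFractionRing R F] {v w : HeightOneSpectrum R} (h : v.valuation F = w.valuation F) :
    v = w :=
  HeightOneSpectrum.eq_of_valuation_isEquiv_valuation (Valuation.IsEquiv.of_eq h)

variable [FunctionField k F] [Algebra.IsSeparable (RatFunc k) F]

theorem valuation_finPrime (P : Place k F) (h : ¬ P.IsInfinite) :
    (P.finPrime h).valuation F = P.val :=
  valuation_centerPrime _ _ _

omit [Algebra k[X] F] [IsScalarTower k k[X] F] [IsScalarTower k[X] (RatFunc k) F] in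
theorem valuation_infPrime (P : Place k F) (h : P.IsInfinite) :
    (P.infPrime h).valuation F = P.val :=
  valuation_centerPrime _ _ _

/-- The valuation of a prime of `O_F` has no pole at t, because t lies in `O_F`; hence it gives a
place that is not over `P_∞`. -/
theorem exists_finPrime_eq (v : HeightOneSpectrum (FunctionField.ringOfIntegers k F)) :
    ∃ (P : Place k F) (h : ¬ P.IsInfinite), P.finPrime h = v := by
  refine ⟨placeOfPrime (fun c => ⟨algebraMap k[X] _ (Polynomial.C c), ?_⟩) v, ?_, ?_⟩
  · rw [← IsScalarTower.algebraMap_apply k[X] _ F, IsScalarTower.algebraMap_apply k k[X] F]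
    rfl
  · rw [Place.isInfinite_iff, not_lt, ← RatFunc.algebraMap_X,
      ← IsScalarTower.algebraMap_apply k[X] (RatFunc k) F,
      IsScalarTower.algebraMap_apply k[X] (FunctionField.ringOfIntegers k F) F]
    exact v.valuation_le_one _
  · exact eq_of_valuation_eq (valuation_finPrime _ _)

theorem vInf_of_ne_zero {x : RatFunc k} (hx : x ≠ 0) :
    vInf k x = WithZero.exp x.intDegree := by
  classical
  have h : vInf k = RatFunc.inftyValuation k := by unfold vInf; congr
  rw [h, RatFunc.inftyValuation_apply, RatFunc.inftyValuation_of_nonzero k hx]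

theorem not_isUnit_AInf_of_lt {x : AInf k} (hx : vInf k (x : RatFunc k) < 1) : ¬ IsUnit x := by
  rw [isUnit_iff_exists_inv]
  rintro ⟨y, hy⟩
  have hy' : vInf k (x : RatFunc k) * vInf k (y : RatFunc k) = 1 := by
    rw [← map_mul, ← map_one (vInf k)]
    exact congrArg (fun z : AInf k => vInf k (z : RatFunc k)) hy
  exact (mul_lt_one_of_lt_of_le hx y.2).ne hy'

theorem vInf_X_inv_lt : vInf k (RatFunc.X : RatFunc k)⁻¹ < 1 := by
  rw [vInf_of_ne_zero (inv_ne_zero RatFunc.X_ne_zero), RatFunc.intDegree_inv, RatFunc.intDegree_X,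
    ← WithZero.exp_zero, WithZero.exp_lt_exp]
  norm_num

/-- By integrality a maximal ideal of `O_{F,∞}` contracts to the maximal ideal of `A_∞`, which
contains 1/t. So t has a pole. -/
theorem isInfinite_placeOfPrime
    (hk : ∀ c : k, ∃ r : OInf k F, algebraMap (OInf k F) F r = algebraMap k F c)
    (v : HeightOneSpectrum (OInf k F)) : (placeOfPrime hk v).IsInfinite := by
  let u : AInf k := ⟨(RatFunc.X)⁻¹, vInf_X_inv_lt.le⟩
  have hmax : v.asIdeal.under (AInf k) = IsLocalRing.maximalIdeal (AInf k) := by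
    have : v.asIdeal.IsMaximal := v.isMaximal
    exact IsLocalRing.eq_maximalIdeal
      (Ideal.isMaximal_comap_of_isIntegral_of_isMaximal (R := AInf k) v.asIdeal)
  have hu : u ∈ v.asIdeal.under (AInf k) := by
    rw [hmax, IsLocalRing.mem_maximalIdeal, mem_nonunits_iff]
    exact not_isUnit_AInf_of_lt vInf_X_inv_lt
  have h1 := (v.valuation_lt_one_iff_mem (K := F) _).2 hu
  rw [Place.isInfinite_iff]
  have h2 : v.valuation F (algebraMap (RatFunc k) F (RatFunc.X)⁻¹) < 1 := h1
  rw [map_inv₀, map_inv₀] at h2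
  refine (inv_lt_one₀ (zero_lt_iff.2 ((Valuation.ne_zero_iff _).2 ?_))).1 h2
  simp [RatFunc.X_ne_zero]

omit [FunctionField k F] [Algebra.IsSeparable (RatFunc k) F] in
theorem exists_OInf_eq_const (c : k) :
    ∃ r : OInf k F, algebraMap (OInf k F) F r = algebraMap k F c := by
  have hc : vInf k (algebraMap k (RatFunc k) c) ≤ 1 := by
    rcases eq_or_ne c 0 with rfl | hc
    · simp
    · rw [vInf_of_ne_zero (by simpa using hc), RatFunc.algebraMap_eq_C, RatFunc.intDegree_C,
        WithZero.exp_zero]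
  exact ⟨algebraMap (AInf k) _ ⟨_, hc⟩, algebraMap_C_eq c⟩

theorem exists_infPrime_eq (v : HeightOneSpectrum (OInf k F)) :
    ∃ (P : Place k F) (h : P.IsInfinite), P.infPrime h = v :=
  ⟨placeOfPrime exists_OInf_eq_const v, isInfinite_placeOfPrime _ v,
    eq_of_valuation_eq (valuation_infPrime _ _)⟩

theorem finIdeal_ne_zero (D : Divisor k F) : finIdeal D ≠ 0 := by
  classical
  refine Finset.prod_ne_zero_iff.2 fun P _ => ?_
  split_ifs with h
  · exact one_ne_zero
  · exact zpow_ne_zero _ (FractionalIdeal.coeIdeal_ne_zero.2 (P.finPrime h).ne_bot)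

theorem mem_finIdeal_iff (D : Divisor k F) {z : F} (hz : z ≠ 0) :
    z ∈ finIdeal D ↔ ∀ P : Place k F, ¬ P.IsInfinite → -D P ≤ P.ord z := by
  classical
  have h := mem_prod_primes_iff (F := F) (s := D.support) (p := fun P => ¬ P.IsInfinite)
    (fun P h => P.finPrime h) (fun P => -D P)
    (fun P Q hP hQ h => Place.ext (by
      rw [← valuation_finPrime P hP, ← valuation_finPrime Q hQ]
      exact congrArg (HeightOneSpectrum.valuation F) h))
    exists_finPrime_eq (fun P hP => by simpa using hP) hz
  simp only [dite_not, valuation_finPrime] at h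
  rw [finIdeal]
  convert! h

omit [Algebra k[X] F] [IsScalarTower k k[X] F] [IsScalarTower k[X] (RatFunc k) F] in
theorem infPrime_injective {P Q : Place k F} (hP : P.IsInfinite) (hQ : Q.IsInfinite)
    (h : P.infPrime hP = Q.infPrime hQ) : P = Q :=
  Place.ext (by
    rw [← valuation_infPrime P hP, ← valuation_infPrime Q hQ]
    exact congrArg (HeightOneSpectrum.valuation F) h)

theorem mem_infIdeal_iff (D : Divisor k F) {z : F} (hz : z ≠ 0) :
    z ∈ infIdeal D ↔ ∀ P : Place k F, P.IsInfinite → -D P ≤ P.ord z := by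
  classical
  have h := mem_prod_primes_iff (F := F) (s := D.support) (p := fun P => P.IsInfinite)
    (fun P h => P.infPrime h) (fun P => -D P)
    (fun P Q hP hQ h => infPrime_injective hP hQ h)
    exists_infPrime_eq (fun P hP => by simpa using hP) hz
  simp only [valuation_infPrime] at h
  rw [infIdeal]
  convert! h

/-- `A_∞` is not a field, as 1/t is a nonunit; so its integral extension `O_{F,∞}` is not a field
either and has a nonzero maximal ideal. This keeps the maximum defining the norm of a nonzero
element above -∞. -/
theorem infinitePlaces_nonempty : (infinitePlaces k F).Nonempty := by
  have hA : ¬ IsField (AInf k) := by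
    intro h
    have hx : (⟨(RatFunc.X : RatFunc k)⁻¹, vInf_X_inv_lt.le⟩ : AInf k) ≠ 0 := fun h =>
      inv_ne_zero RatFunc.X_ne_zero (congrArg (fun z : AInf k => (z : RatFunc k)) h)
    exact not_isUnit_AInf_of_lt vInf_X_inv_lt (isUnit_iff_exists_inv.2 (h.mul_inv_cancel hx))
  have hinj : Function.Injective (algebraMap (AInf k) (OInf k F)) := by
    intro x y hxy
    exact Subtype.ext ((algebraMap (RatFunc k) F).injective
      (congrArg (fun z : OInf k F => (z : F)) hxy))
  have hO : ¬ IsField (OInf k F) := fun h =>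
    hA ((Algebra.IsIntegral.isField_iff_isField hinj).2 h)
  obtain ⟨M, hM⟩ := Ideal.exists_maximal (OInf k F)
  obtain ⟨P, hP, -⟩ := exists_infPrime_eq
    (F := F) ⟨M, hM.isPrime, fun h => hO (Ring.isField_iff_maximal_bot.2 (h ▸ hM))⟩
  exact ⟨P, (Set.Finite.mem_toFinset _).2 hP⟩

end FunctionFields

/-! ### Common denominators -/

section Denominators

/-- The coordinates of a fractional ideal of the integral closure have a common denominator. -/
theorem exists_denominator {R K F O : Type*} [CommRing R] [IsDomain R] [IsNoetherianRing R]
    [Field K] [Algebra R K] [IsFractionRing R K] [Field F]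
    [Algebra K F] [Algebra R F] [IsScalarTower R K F]
    [CommRing O] [IsDedekindDomain O] [Algebra R O] [Algebra O F]
    [IsFractionRing O F] [IsScalarTower R O F] [Module.Finite R O]
    (J : FractionalIdeal O⁰ F) (φ : F →ₗ[K] K) :
    ∃ d : R, d ≠ 0 ∧ ∀ y ∈ J, ∃ r : R, algebraMap R K d * φ y = algebraMap R K r := by
  -- J is finitely generated over `O`, hence over `R`; its image under φ is then a finitely
  -- generated `R`-submodule of `K`, which has a common denominator.
  have hfg : ((J : Submodule O F).restrictScalars R).FG := by
    have h1 : Module.Finite O (J : Submodule O F) :=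
      Module.Finite.iff_fg.2 (FractionalIdeal.fg_of_isNoetherianRing le_rfl J)
    have h2 : Module.Finite R (J : Submodule O F) := Module.Finite.trans O _
    exact Module.Finite.iff_fg.1 (inferInstanceAs (Module.Finite R (J : Submodule O F)))
  have hfg' := hfg.map (φ.restrictScalars R)
  obtain ⟨d, hd, h⟩ := FractionalIdeal.isFractional_of_fg (S := R⁰) hfg'
  refine ⟨d, nonZeroDivisors.ne_zero hd, fun y hy => ?_⟩
  obtain ⟨r, hr⟩ := h (φ y) ⟨y, hy, rfl⟩
  exact ⟨r, by rw [hr, Algebra.smul_def]⟩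

end Denominators

/-! ### The norm of a divisor and Riemann-Roch spaces -/

section FunctionFields

theorem intDegree_X_zpow {k : Type*} [Field k] (r : ℤ) :
    ((RatFunc.X : RatFunc k) ^ r).intDegree = r := by
  have h := vInf_of_ne_zero (zpow_ne_zero r (RatFunc.X_ne_zero (K := k)))
  rw [map_zpow₀, vInf_of_ne_zero RatFunc.X_ne_zero, RatFunc.intDegree_X, ← WithZero.exp_zsmul,
    WithZero.exp_inj] at h
  simpa using h.symm

variable {k F : Type*} [Field k] [Field F]

theorem Place.ord_mul [Algebra k F] (P : Place k F) {x y : F} (hx : x ≠ 0) (hy : y ≠ 0) :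
    P.ord (x * y) = P.ord x + P.ord y := by
  rw [Place.ord, Place.ord, Place.ord, map_mul, WithZero.log_mul]
  · ring
  · exact (Valuation.ne_zero_iff _).2 hx
  · exact (Valuation.ne_zero_iff _).2 hy

variable [Algebra k F] [Algebra k[X] F] [Algebra (RatFunc k) F]
  [IsScalarTower k k[X] F] [IsScalarTower k[X] (RatFunc k) F]

theorem isScalarTower_ratFunc : IsScalarTower k (RatFunc k) F :=
  IsScalarTower.of_algebraMap_eq fun c => (algebraMap_C_eq c).symm

variable [FunctionField k F] [Algebra.IsSeparable (RatFunc k) F]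

omit [Algebra k[X] F] [IsScalarTower k k[X] F] [IsScalarTower k[X] (RatFunc k) F] in
theorem mem_infinitePlaces {P : Place k F} : P ∈ infinitePlaces k F ↔ P.IsInfinite :=
  Set.Finite.mem_toFinset _

theorem poleDivisor_of_isInfinite {P : Place k F} (h : P.IsInfinite) :
    poleDivisor k F P = P.ramificationIdx := by
  have h1 := P.ramificationIdx_pos h
  have h2 := P.ord_algebraMap h RatFunc.X
  rw [RatFunc.intDegree_X] at h2
  change max 0 (-P.ord (algebraMap (RatFunc k) F RatFunc.X)) = _
  rw [h2]
  simp [h1.le]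

theorem poleDivisor_of_not_isInfinite {P : Place k F} (h : ¬ P.IsInfinite) :
    poleDivisor k F P = 0 := by
  by_contra h1
  refine h (mem_infinitePlaces.1 ?_)
  exact Finsupp.support_onFinset_subset (Finsupp.mem_support_iff.2 h1)

theorem divNorm_le_iff (D : Divisor k F) {z : F} (hz : z ≠ 0) (r : ℝ) :
    divNorm D z ≤ (r : WithBot ℝ) ↔ ∀ P : Place k F, P.IsInfinite →
      -(D P : ℝ) - r * (P.ramificationIdx : ℝ) ≤ (P.ord z : ℝ) := by
  rw [divNorm, if_neg hz, Finset.sup_le_iff]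
  refine forall_congr' fun P => ?_
  rw [mem_infinitePlaces]
  refine forall_congr' fun h => ?_
  have he : (0 : ℝ) < P.ramificationIdx := by exact_mod_cast P.ramificationIdx_pos h
  rw [WithBot.coe_le_coe, neg_le, le_div_iff₀ he]
  constructor <;> intro h <;> linarith

/-- Clearing the positive denominators e(P/P_∞) leaves inequalities between integers, the form used
for divisors. -/
theorem divNorm_le_intCast_iff (D : Divisor k F) {z : F} (hz : z ≠ 0) (r : ℤ) :
    divNorm D z ≤ (((r : ℤ) : ℝ) : WithBot ℝ) ↔ ∀ P : Place k F, P.IsInfinite →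
      -D P - r * P.ramificationIdx ≤ P.ord z := by
  rw [divNorm_le_iff D hz]
  exact_mod_cast Iff.rfl

omit [Algebra k[X] F] [IsScalarTower k k[X] F] [IsScalarTower k[X] (RatFunc k) F] in
theorem divNorm_zero (D : Divisor k F) : divNorm D 0 = ⊥ := if_pos rfl

theorem mem_finModule_iff (D : Divisor k F) {z : F} (hz : z ≠ 0) :
    z ∈ finModule D ↔ ∀ P : Place k F, ¬ P.IsInfinite → -D P ≤ P.ord z :=
  mem_finIdeal_iff D hz

/-- The pole divisor vanishes at finite places and has coefficient e(P/P_∞) at infinite ones, so the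
conditions split into membership in I and a norm bound. -/
theorem mem_RRSpace_iff (D : Divisor k F) (r : ℤ) {z : F} :
    z ∈ RRSpace (D + r • poleDivisor k F) ↔
      z ∈ finModule D ∧ divNorm D z ≤ (((r : ℤ) : ℝ) : WithBot ℝ) := by
  rcases eq_or_ne z 0 with rfl | hz
  · simp [divNorm_zero]
  rw [mem_finModule_iff D hz, divNorm_le_intCast_iff D hz]
  change (z = 0 ∨ ∀ P : Place k F, -(D + r • poleDivisor k F) P ≤ P.ord z) ↔ _
  rw [or_iff_right hz]
  simp only [Finsupp.add_apply, Finsupp.smul_apply, smul_eq_mul]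
  constructor
  · refine fun h => ⟨fun P hP => ?_, fun P hP => ?_⟩
    · simpa [poleDivisor_of_not_isInfinite hP] using h P
    · have := h P
      rw [poleDivisor_of_isInfinite hP] at this
      linarith
  · rintro ⟨h1, h2⟩ P
    by_cases hP : P.IsInfinite
    · rw [poleDivisor_of_isInfinite hP]
      linarith [h2 P hP]
    · rw [poleDivisor_of_not_isInfinite hP]
      simpa using h1 P hP

theorem mem_infIdeal_iff_divNorm (D : Divisor k F) {z : F} :
    z ∈ infIdeal D ↔ divNorm D z ≤ ((0 : ℝ) : WithBot ℝ) := by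
  rcases eq_or_ne z 0 with rfl | hz
  · rw [divNorm_zero]
    exact iff_of_true (infIdeal D : Submodule (OInf k F) F).zero_mem bot_le
  rw [mem_infIdeal_iff D hz, ← Int.cast_zero, divNorm_le_intCast_iff D hz]
  simp

/-- Since v_P(a) = -e(P/P_∞) deg a, division by e makes every term of the maximum move by the same
amount deg a. -/
theorem divNorm_smul (D : Divisor k F) (a : RatFunc k) (z : F) :
    divNorm D (a • z) = degK a + divNorm D z := by
  rcases eq_or_ne a 0 with rfl | ha
  · simp [divNorm_zero, degK]
  rcases eq_or_ne z 0 with rfl | hz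
  · simp [divNorm_zero]
  have haF : algebraMap (RatFunc k) F a ≠ 0 := by simpa using ha
  rw [divNorm, divNorm, if_neg (smul_ne_zero ha hz), if_neg hz, degK, if_neg ha]
  rw [Finset.apply_sup_eq_sup_comp_of_nonempty (g := fun x => ((a.intDegree : ℝ) : WithBot ℝ) + x)
    (fun x y h => by dsimp only; gcongr) infinitePlaces_nonempty]
  refine Finset.sup_congr rfl fun P hP => ?_
  have h := mem_infinitePlaces.1 hP
  have he : (P.ramificationIdx : ℝ) ≠ 0 := by exact_mod_cast (P.ramificationIdx_pos h).ne'
  rw [Function.comp_apply, ← WithBot.coe_add, Algebra.smul_def, P.ord_mul haF hz,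
    P.ord_algebraMap h]
  congr 1
  push_cast
  field_simp
  ring

theorem divNorm_eq_bot_iff (D : Divisor k F) (z : F) : divNorm D z = ⊥ ↔ z = 0 := by
  refine ⟨fun h => ?_, fun h => h ▸ divNorm_zero D⟩
  by_contra hz
  obtain ⟨P, hP⟩ := infinitePlaces_nonempty (k := k) (F := F)
  rw [divNorm, if_neg hz, Finset.sup_eq_bot_iff] at h
  exact WithBot.coe_ne_bot (h P hP)

theorem divNorm_add_le (D : Divisor k F) (x y : F) :
    divNorm D (x + y) ≤ max (divNorm D x) (divNorm D y) := by
  rcases eq_or_ne x 0 with rfl | hx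
  · simp
  rcases eq_or_ne y 0 with rfl | hy
  · simp
  by_cases hxy : x + y = 0
  · rw [hxy, divNorm_zero]; exact bot_le
  -- The larger norm is a real number r because x ≠ 0; it then suffices to check the bound r place
  -- by place.
  obtain ⟨r, hr⟩ := WithBot.ne_bot_iff_exists.1 (ne_bot_of_le_ne_bot
    (mt (divNorm_eq_bot_iff D x).1 hx) (le_max_left (divNorm D x) (divNorm D y)))
  have h1 := (divNorm_le_iff D hx r).1 (hr ▸ le_max_left _ _)
  have h2 := (divNorm_le_iff D hy r).1 (hr ▸ le_max_right _ _)
  rw [← hr, divNorm_le_iff D hxy]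
  intro P hP
  have h3 := P.val.map_add x y
  rw [P.val_eq_exp hxy, P.val_eq_exp hx, P.val_eq_exp hy, le_max_iff, WithZero.exp_le_exp,
    WithZero.exp_le_exp, neg_le_neg_iff, neg_le_neg_iff] at h3
  rcases h3 with h3 | h3
  · exact (h1 P hP).trans (by exact_mod_cast h3)
  · exact (h2 P hP).trans (by exact_mod_cast h3)

theorem isNorm_divNorm (D : Divisor k F) : IsNorm k (RatFunc k) (divNorm D) :=
  ⟨divNorm_add_le D, divNorm_smul D, divNorm_eq_bot_iff D⟩

theorem isNorm_finModule (D : Divisor k F) :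
    IsNorm k k[X] (fun z : finModule D => divNorm D (z : F)) where
  add_le x y := divNorm_add_le D x y
  smul a x := by
    rw [← divNorm_smul, algebraMap_smul]
    rfl
  eq_bot_iff x := by
    rw [divNorm_eq_bot_iff, Submodule.coe_eq_zero]

/-- `I_∞` is the unit ball, and multiplication by t^r raises the norm by r. -/
theorem mem_image_infIdeal_iff (D : Divisor k F) (r : ℤ) {z : F} :
    z ∈ (fun y : F => algebraMap (RatFunc k) F (RatFunc.X ^ r) * y) '' {y : F | y ∈ infIdeal D} ↔
      divNorm D z ≤ (((r : ℤ) : ℝ) : WithBot ℝ) := by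
  have hX : (RatFunc.X : RatFunc k) ^ r ≠ 0 := zpow_ne_zero _ RatFunc.X_ne_zero
  have key : ∀ y : F, y ∈ infIdeal D ↔
      divNorm D (algebraMap (RatFunc k) F (RatFunc.X ^ r) * y) ≤
        (((r : ℤ) : ℝ) : WithBot ℝ) := by
    intro y
    rw [mem_infIdeal_iff_divNorm, ← Algebra.smul_def, divNorm_smul, degK, if_neg hX,
      intDegree_X_zpow]
    cases divNorm D y with
    | bot => simp
    | coe x =>
      rw [← WithBot.coe_add, WithBot.coe_le_coe, WithBot.coe_le_coe]
      constructor <;> intro h <;> linarith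
  constructor
  · rintro ⟨y, hy, rfl⟩
    exact (key y).1 hy
  · intro h
    have hXF : algebraMap (RatFunc k) F (RatFunc.X ^ r) ≠ 0 := by
      rwa [Ne, FaithfulSMul.algebraMap_eq_zero_iff]
    have hz : algebraMap (RatFunc k) F (RatFunc.X ^ r) *
        ((algebraMap (RatFunc k) F (RatFunc.X ^ r))⁻¹ * z) = z := mul_inv_cancel_left₀ hXF z
    exact ⟨_, (key _).2 (by rwa [hz]), hz⟩

end FunctionFields

/-! ### Finite dimensionality, the lattice and the normed space -/

section FunctionFields

variable {k F : Type*} [Field k] [Field F]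
variable [Algebra k F] [Algebra k[X] F] [Algebra (RatFunc k) F]
  [IsScalarTower k k[X] F] [IsScalarTower k[X] (RatFunc k) F]
variable [FunctionField k F] [Algebra.IsSeparable (RatFunc k) F]

instance : Module.Finite (AInf k) (OInf k F) :=
  IsIntegralClosure.finite (AInf k) (RatFunc k) F _

instance : Module.Finite k[X] (FunctionField.ringOfIntegers k F) :=
  IsIntegralClosure.finite k[X] (RatFunc k) F _

/-- Write z = t^r y with y in `I_∞`. A denominator d for φ on I makes p = dφ(z) a polynomial; a
denominator c for φ on `I_∞` gives deg(cφ(y)) ≤ 0 when φ(y) ≠ 0. Hence deg p is bounded and φ(z) =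
p/d ranges over a finite-dimensional space. -/
theorem exists_coordinate_space (D : Divisor k F) (r : ℤ) (φ : F →ₗ[RatFunc k] RatFunc k) :
    ∃ W : Submodule k (RatFunc k), FiniteDimensional k W ∧
      ∀ z ∈ RRSpace (D + r • poleDivisor k F), φ z ∈ W := by
  obtain ⟨d, hd, h1⟩ := exists_denominator (R := k[X]) (finIdeal D) φ
  obtain ⟨c, hc, h2⟩ := exists_denominator (R := AInf k) (infIdeal D) φ
  have hd' : algebraMap k[X] (RatFunc k) d ≠ 0 := by simpa using hd
  have hc' : (c : RatFunc k) ≠ 0 := fun h => hc (Subtype.ext h)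
  -- The bound for deg p = deg d + r + deg φ(y), using deg φ(y) ≤ -deg c. If m is negative, `(m +
  -- 1).toNat` is 0 and only p = 0 remains.
  let m : ℤ := r + (d.natDegree : ℤ) - (c : RatFunc k).intDegree
  let f : k[X] →ₗ[k] RatFunc k :=
    LinearMap.mulLeft k (algebraMap k[X] (RatFunc k) d)⁻¹ ∘ₗ
      (Algebra.linearMap k[X] (RatFunc k)).restrictScalars k
  refine ⟨(Polynomial.degreeLT k (m + 1).toNat).map f, inferInstance, fun z hz => ?_⟩
  rw [mem_RRSpace_iff, ← mem_image_infIdeal_iff] at hz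
  obtain ⟨hzI, y, hy, rfl⟩ := hz
  obtain ⟨p, hp⟩ := h1 _ hzI
  obtain ⟨q, hq⟩ := h2 _ hy
  dsimp only at hp ⊢
  have hφX : φ (algebraMap (RatFunc k) F (RatFunc.X ^ r) * y) = RatFunc.X ^ r * φ y := by
    rw [← Algebra.smul_def (RatFunc.X ^ r : RatFunc k) y, map_smul, smul_eq_mul]
  rw [hφX] at hp ⊢
  change (c : RatFunc k) * φ y = (q : RatFunc k) at hq
  refine ⟨p, ?_, ?_⟩
  · rw [SetLike.mem_coe, Polynomial.mem_degreeLT]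
    rcases eq_or_ne p 0 with rfl | hp0
    · simp
    rw [← Polynomial.natDegree_lt_iff_degree_lt hp0]
    have hp0' : algebraMap k[X] (RatFunc k) p ≠ 0 := by simpa using hp0
    have hφ : φ y ≠ 0 := by
      intro h; rw [h, mul_zero, mul_zero] at hp; exact hp0' hp.symm
    have hX : (RatFunc.X : RatFunc k) ^ r ≠ 0 := zpow_ne_zero _ RatFunc.X_ne_zero
    have e1 := congrArg RatFunc.intDegree hp
    rw [RatFunc.intDegree_mul hd' (mul_ne_zero hX hφ), RatFunc.intDegree_mul hX hφ,
      intDegree_X_zpow, RatFunc.intDegree_polynomial, RatFunc.intDegree_polynomial] at e1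
    have e2 := congrArg RatFunc.intDegree hq
    rw [RatFunc.intDegree_mul hc' hφ] at e2
    have hq0 : (q : RatFunc k) ≠ 0 := hq ▸ mul_ne_zero hc' hφ
    have e3 : vInf k (q : RatFunc k) ≤ 1 := q.2
    rw [vInf_of_ne_zero hq0, ← WithZero.exp_zero, WithZero.exp_le_exp] at e3
    omega
  · change (algebraMap k[X] (RatFunc k) d)⁻¹ * algebraMap k[X] (RatFunc k) p = _
    rw [← hp, inv_mul_cancel_left₀ hd']

/-- The coordinates in a k(t)-basis of F embed the space k-linearly into a finite product of
finite-dimensional spaces. -/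
theorem finiteDimensional_RRSpace (D : Divisor k F) (r : ℤ) :
    FiniteDimensional k (RRSpace (D + r • poleDivisor k F)) := by
  have : IsScalarTower k (RatFunc k) F := isScalarTower_ratFunc
  let e := Module.finBasis (RatFunc k) F
  choose W hW h using fun i => exists_coordinate_space D r (e.coord i)
  let f : RRSpace (D + r • poleDivisor k F) →ₗ[k] (∀ i, W i) :=
    LinearMap.pi fun i => (((e.coord i).restrictScalars k).domRestrict _).codRestrict (W i)
      fun z => h i z z.2
  refine FiniteDimensional.of_injective f fun x y hxy => Subtype.ext (e.ext_elem fun i => ?_)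
  exact congrArg Subtype.val (congrFun hxy i)

theorem isLattice_finModule (D : Divisor k F) :
    IsLattice k (fun z : finModule D => divNorm D (z : F)) := by
  refine ⟨?_, isNorm_finModule D, fun r => ?_⟩
  · have h1 : Module.Finite (FunctionField.ringOfIntegers k F)
        (finIdeal D : Submodule (FunctionField.ringOfIntegers k F) F) :=
      Module.Finite.iff_fg.2 (FractionalIdeal.fg_of_isNoetherianRing le_rfl _)
    exact Module.Finite.trans (R := k[X]) (FunctionField.ringOfIntegers k F)
        (finIdeal D : Submodule (FunctionField.ringOfIntegers k F) F)
  -- For real r the sublevel space embeds into the one for ⌈r⌉.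
  · have := finiteDimensional_RRSpace D ⌈r⌉
    let f : (isNorm_finModule D).sublevel r →ₗ[k] RRSpace (D + ⌈r⌉ • poleDivisor k F) :=
      { toFun := fun z => ⟨z.1.1, (mem_RRSpace_iff D _).2 ⟨z.1.2, z.2.trans
          (WithBot.coe_le_coe.2 (Int.le_ceil r))⟩⟩
        map_add' := fun _ _ => rfl
        map_smul' := fun _ _ => rfl }
    refine FiniteDimensional.of_injective f fun x y hxy => Subtype.ext (Subtype.ext ?_)
    exact congrArg (fun z : RRSpace (D + ⌈r⌉ • poleDivisor k F) => (z : F)) hxy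

/-- Fix a nonzero y in I. For any x some nonzero polynomial a makes a(x/y) integral, so ax lies in
I. -/
theorem span_finModule (D : Divisor k F) :
    Submodule.span (RatFunc k) (finModule D : Set F) = ⊤ := by
  obtain ⟨y, hy, hy0⟩ : ∃ y ∈ finIdeal D, y ≠ 0 := by
    by_contra! h
    exact finIdeal_ne_zero D (FractionalIdeal.eq_zero_iff.2 h)
  rw [eq_top_iff]
  rintro x -
  have halg : IsAlgebraic k[X] (x / y) :=
    (IsFractionRing.isAlgebraic_iff k[X] (RatFunc k) F).2 (Algebra.IsAlgebraic.isAlgebraic _)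
  obtain ⟨a, ha, hint⟩ := halg.exists_integral_multiple
  have hmem : a • x ∈ finModule D := by
    have h := (finIdeal D : Submodule (FunctionField.ringOfIntegers k F) F).smul_mem
      ⟨a • (x / y), hint⟩ hy
    have e : (⟨a • (x / y), hint⟩ : FunctionField.ringOfIntegers k F) • y = a • x := by
      change (a • (x / y)) * y = a • x
      rw [smul_mul_assoc, div_mul_cancel₀ _ hy0]
    rwa [e] at h
  have ha' : algebraMap k[X] (RatFunc k) a ≠ 0 := by simpa using ha
  have h2 := (Submodule.span (RatFunc k) (finModule D : Set F)).smul_mem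
    (algebraMap k[X] (RatFunc k) a)⁻¹ (Submodule.subset_span hmem)
  rwa [← algebraMap_smul (RatFunc k) a x, inv_smul_smul₀ ha'] at h2

theorem isNormedSpace_divNorm (D : Divisor k F) : IsNormedSpace k (divNorm D) :=
  ⟨inferInstance, isNorm_divNorm D, finModule D, span_finModule D, isLattice_finModule D⟩

end FunctionFields

/-! ### Semi-reduced families and degree bounds -/

section SemiReduced

theorem ceilBot_le_iff (x : WithBot ℝ) (r : ℤ) :
    ceilBot x ≤ (r : WithBot ℤ) ↔ x ≤ (((r : ℤ) : ℝ) : WithBot ℝ) := by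
  cases x with
  | bot => simp [ceilBot]
  | coe x =>
    change ((⌈x⌉ : ℤ) : WithBot ℤ) ≤ _ ↔ _
    rw [WithBot.coe_le_coe, WithBot.coe_le_coe, Int.ceil_le]

theorem sub_ceilLength_iff {E : Type*} {N : E → WithBot ℝ} {x : E} (hx : N x ≠ ⊥) (m r : ℤ) :
    (((m : ℤ) : ℝ) : WithBot ℝ) + N x ≤ (((r : ℤ) : ℝ) : WithBot ℝ) ↔
      m ≤ r - ceilLength N x := by
  obtain ⟨y, hy⟩ := WithBot.ne_bot_iff_exists.1 hx
  have hc : ceilLength N x = ⌈y⌉ := by rw [ceilLength, ← hy]; rfl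
  rw [hc, ← hy, ← WithBot.coe_add, WithBot.coe_le_coe, le_sub_comm, Int.ceil_le, Int.cast_sub,
    le_sub_iff_add_le']

/-- An integral threshold does not see the difference between a norm and its ceiling, so
semi-reducedness lets each summand be bounded alone. Phrasing the degree bound through nonzero
coefficients covers pᵢ = 0 as well. -/
theorem IsSemiReduced.le_iff {k E ι : Type*} [Field k] [AddCommGroup E] [Module (RatFunc k) E]
    [Fintype ι] {N : E → WithBot ℝ} (hN : IsNorm k (RatFunc k) N) {b : ι → E}
    (hb : IsSemiReduced k N b) (hb0 : ∀ i, b i ≠ 0) (p : ι → k[X]) (r : ℤ) :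
    N (∑ i, algebraMap k[X] (RatFunc k) (p i) • b i) ≤ (((r : ℤ) : ℝ) : WithBot ℝ) ↔
      ∀ i j, (p i).coeff j ≠ 0 → (j : ℤ) ≤ r - ceilLength N (b i) := by
  rw [← ceilBot_le_iff, hb, Finset.sup_le_iff]
  simp only [Finset.mem_univ, true_imp_iff, ceilBot_le_iff, hN.smul]
  refine forall_congr' fun i => ?_
  have hbot : N (b i) ≠ ⊥ := mt (hN.eq_bot_iff _).1 (hb0 i)
  rcases eq_or_ne (p i) 0 with h0 | h0
  · simp [h0, degK]
  · have h0' : algebraMap k[X] (RatFunc k) (p i) ≠ 0 := by simpa using h0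
    rw [Algebra.algebraMap_self_apply, degK, if_neg h0', RatFunc.intDegree_polynomial,
      sub_ceilLength_iff hbot]
    constructor
    · intro h j hj
      exact (Int.ofNat_le.2 (Polynomial.le_natDegree_of_ne_zero hj)).trans h
    · intro h
      exact h _ (by simpa using h0)

end SemiReduced

/-! ### Monomial bases and the dimension formula -/

section FunctionFields

variable {k F : Type*} [Field k] [Field F]
variable [Algebra k F] [Algebra k[X] F] [Algebra (RatFunc k) F]
  [IsScalarTower k k[X] F] [IsScalarTower k[X] (RatFunc k) F]

/-- The `k`-basis `bᵢ tʲ` of a `k[t]`-submodule of `F` with basis `b`. -/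
noncomputable def monomialBasis {ι : Type*} {I : Submodule k[X] F}
    (b : Module.Basis ι k[X] I) : Module.Basis (ℕ × ι) k I :=
  (Polynomial.basisMonomials k).smulTower b

omit [IsScalarTower k[X] (RatFunc k) F] [Algebra (RatFunc k) F] in
theorem monomialBasis_repr {ι : Type*} {I : Submodule k[X] F} (b : Module.Basis ι k[X] I)
    (z : I) (j : ℕ) (i : ι) : (monomialBasis b).repr z (j, i) = (b.repr z i).coeff j := by
  rw [monomialBasis, Module.Basis.smulTower_repr]
  rfl

theorem coe_monomialBasis {ι : Type*} {I : Submodule k[X] F} (b : Module.Basis ι k[X] I)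
    (j : ℕ) (i : ι) :
    (monomialBasis b (j, i) : F) = (b i : F) * algebraMap (RatFunc k) F RatFunc.X ^ j := by
  rw [monomialBasis, Module.Basis.smulTower_apply, Polynomial.coe_basisMonomials,
    Submodule.coe_smul, Algebra.smul_def]
  dsimp only
  rw [Polynomial.monomial_one_right_eq_X_pow, map_pow,
    ← RatFunc.algebraMap_X, ← IsScalarTower.algebraMap_apply k[X] (RatFunc k) F, mul_comm]

theorem support_subset_iff {ι M : Type*} [Zero M] (f : ℕ × ι →₀ M) (S : ℕ → ι → Prop) :
    (f.support : Set (ℕ × ι)) ⊆ {q | S q.1 q.2} ↔ ∀ i j, f (j, i) ≠ 0 → S j i :=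
  ⟨fun h _ _ hij => h (Finset.mem_coe.2 (Finsupp.mem_support_iff.2 hij)),
    fun h q hq => h q.2 q.1 (Finsupp.mem_support_iff.1 (Finset.mem_coe.1 hq))⟩

/-- Pairs `(i, j)` with `0 ≤ j ≤ r - cᵢ`. -/
def indexEquiv {ι : Type*} (c : ι → ℤ) (r : ℤ) :
    {p : ι × ℕ // (p.2 : ℤ) ≤ r - c p.1} ≃ Σ i, Fin (r - c i + 1).toNat where
  toFun p := ⟨p.1.1, p.1.2, by have := p.2; omega⟩
  invFun q := ⟨(q.1, q.2.1), by have := q.2.2; dsimp only; omega⟩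
  left_inv _ := rfl
  right_inv _ := rfl

/-- The exponents 0, …, r - cᵢ number r - cᵢ + 1 if cᵢ ≤ r; otherwise there are none, which `toNat`
reflects on one side and the filter on the other. -/
theorem card_index {ι : Type*} [Fintype ι] (c : ι → ℤ) (r : ℤ) :
    (Nat.card {p : ι × ℕ // (p.2 : ℤ) ≤ r - c p.1} : ℤ) =
      ∑ i with c i ≤ r, (r - c i + 1) := by
  rw [Nat.card_congr (indexEquiv c r), Nat.card_sigma, Finset.sum_filter]
  push_cast
  refine Finset.sum_congr rfl fun i _ => ?_
  rw [Nat.card_fin]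
  split_ifs <;> omega

variable [FunctionField k F] [Algebra.IsSeparable (RatFunc k) F]

/-- Coefficients of the k[t]-coordinates are the k-coordinates in the monomial basis, so the degree
bounds become a condition on the support. -/
theorem mem_RRSpace_iff_repr (D : Divisor k F) {n : ℕ}
    (b : Module.Basis (Fin n) k[X] (finModule D))
    (hb : IsSemiReduced k (divNorm D) (fun i => (b i : F))) (r : ℤ) (z : finModule D) :
    (z : F) ∈ RRSpace (D + r • poleDivisor k F) ↔
      ∀ i j, (monomialBasis b).repr z (j, i) ≠ 0 →
        (j : ℤ) ≤ r - ceilLength (divNorm D) (b i : F) := by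
  have h := hb.le_iff (isNorm_divNorm D) (fun i h => b.ne_zero i (Subtype.ext h))
    (fun i => b.repr z i) r
  have hz : (∑ i, algebraMap k[X] (RatFunc k) (b.repr z i) • (b i : F)) = z := by
    simp only [algebraMap_smul]
    exact (Submodule.coe_sum _ _ _).symm.trans (congrArg Subtype.val (b.sum_repr z))
  rw [hz] at h
  rw [mem_RRSpace_iff, h]
  simp only [monomialBasis_repr, SetLike.coe_mem, true_and]

theorem range_monomials (D : Divisor k F) {n : ℕ}
    (b : Module.Basis (Fin n) k[X] (finModule D)) (c : Fin n → ℤ) (r : ℤ) :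
    Set.range (fun p : {p : Fin n × ℕ // (p.2 : ℤ) ≤ r - c p.1} =>
        (b p.1.1 : F) * algebraMap (RatFunc k) F RatFunc.X ^ p.1.2) =
      ((finModule D).subtype.restrictScalars k) ''
        (monomialBasis b '' {q | (q.1 : ℤ) ≤ r - c q.2}) := by
  ext z
  simp only [Set.mem_range, Set.mem_image]
  constructor
  · rintro ⟨⟨⟨i, j⟩, h⟩, rfl⟩
    exact ⟨_, ⟨(j, i), h, rfl⟩, coe_monomialBasis b j i⟩
  · rintro ⟨_, ⟨⟨j, i⟩, h, rfl⟩, rfl⟩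
    exact ⟨⟨(i, j), h⟩, (coe_monomialBasis b j i).symm⟩

theorem linearIndependent_monomials (D : Divisor k F) {n : ℕ}
    (b : Module.Basis (Fin n) k[X] (finModule D)) (c : Fin n → ℤ) (r : ℤ) :
    LinearIndependent k (fun p : {p : Fin n × ℕ // (p.2 : ℤ) ≤ r - c p.1} =>
        (b p.1.1 : F) * algebraMap (RatFunc k) F RatFunc.X ^ p.1.2) := by
  have h1 := (monomialBasis b).linearIndependent.map' ((finModule D).subtype.restrictScalars k)
    (LinearMap.ker_eq_bot.2 Subtype.val_injective)
  have h2 := h1.comp (fun p : {p : Fin n × ℕ // (p.2 : ℤ) ≤ r - c p.1} => (p.1.2, p.1.1))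
    (fun p q h => Subtype.ext (Prod.ext (congrArg Prod.snd h) (congrArg Prod.fst h)))
  convert! h2 using 2 with p
  exact (coe_monomialBasis b p.1.2 p.1.1).symm

/-- A vector lies in the span of a subset of a basis exactly when its support lies in that subset;
`mem_RRSpace_iff_repr` describes the Riemann-Roch space by such a support condition. -/
theorem span_monomials (D : Divisor k F) {n : ℕ}
    (b : Module.Basis (Fin n) k[X] (finModule D))
    (hb : IsSemiReduced k (divNorm D) (fun i => (b i : F))) (r : ℤ) :
    Submodule.span k
      (Set.range (fun p : {p : Fin n × ℕ //
          (p.2 : ℤ) ≤ r - ceilLength (divNorm D) (b p.1 : F)} =>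
        (b p.1.1 : F) * algebraMap (RatFunc k) F RatFunc.X ^ p.1.2)) =
      RRSpace (D + r • poleDivisor k F) := by
  rw [range_monomials D b (fun i => ceilLength (divNorm D) (b i : F)) r, Submodule.span_image]
  have key : ∀ z : finModule D,
      z ∈ Submodule.span k (monomialBasis b ''
        {q | (q.1 : ℤ) ≤ r - ceilLength (divNorm D) (b q.2 : F)}) ↔
      (z : F) ∈ RRSpace (D + r • poleDivisor k F) := by
    intro z
    rw [mem_RRSpace_iff_repr D b hb, Module.Basis.mem_span_image]
    exact support_subset_iff _ (fun j i => (j : ℤ) ≤ r - ceilLength (divNorm D) (b i : F))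
  ext z
  constructor
  · rintro ⟨z, hz, rfl⟩
    exact (key z).1 hz
  · intro hz
    exact ⟨⟨z, ((mem_RRSpace_iff D r).1 hz).1⟩, (key _).2 hz, rfl⟩

theorem finrank_RRSpace (D : Divisor k F) {n : ℕ}
    (b : Module.Basis (Fin n) k[X] (finModule D))
    (hb : IsSemiReduced k (divNorm D) (fun i => (b i : F))) (r : ℤ) :
    (Module.finrank k (RRSpace (D + r • poleDivisor k F)) : ℤ) =
      ∑ i : Fin n with ceilLength (divNorm D) (b i : F) ≤ r,
        (r - ceilLength (divNorm D) (b i : F) + 1) := by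
  rw [← card_index, ← span_monomials D b hb r]
  have := Fintype.ofEquiv _ (indexEquiv (fun i => ceilLength (divNorm D) (b i : F)) r).symm
  have h := finrank_span_eq_card
    (linearIndependent_monomials D b (fun i => ceilLength (divNorm D) (b i : F)) r)
  rw [Nat.card_eq_fintype_card]
  exact congrArg Nat.cast h

end FunctionFields
end FFLattice

theorem mainTheorem6 {k F : Type*} [Field k] [Field F]
    [Algebra k F] [Algebra k[X] F] [Algebra (RatFunc k) F]
    [IsScalarTower k k[X] F] [IsScalarTower k[X] (RatFunc k) F]
    [FunctionField k F] [Algebra.IsSeparable (RatFunc k) F]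
    (D : FFLattice.Divisor k F) :
    -- `L(D + r(t)_∞) = I ∩ t^r I_∞ = (I, ‖ ‖_D)_{≤ r}`
    (∀ r : ℤ,
      (FFLattice.RRSpace (D + r • FFLattice.poleDivisor k F) : Set F) =
          (FFLattice.finModule D : Set F) ∩
            (fun y : F => algebraMap (RatFunc k) F (RatFunc.X ^ r) * y) ''
              {y : F | y ∈ FFLattice.infIdeal D} ∧
      (FFLattice.RRSpace (D + r • FFLattice.poleDivisor k F) : Set F) =
          {z : F | z ∈ FFLattice.finModule D ∧
            FFLattice.divNorm D z ≤ (((r : ℤ) : ℝ) : WithBot ℝ)}) ∧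
    -- `(I, ‖ ‖_D)` is a lattice and `(F, ‖ ‖_D)` is a normed space
    FFLattice.IsLattice k (fun z : FFLattice.finModule D => FFLattice.divNorm D (z : F)) ∧
    FFLattice.IsNormedSpace k (FFLattice.divNorm D) ∧
    -- `I_∞ = (F, ‖ ‖_D)_{≤ 0}`
    {z : F | z ∈ FFLattice.infIdeal D} =
      {z : F | FFLattice.divNorm D z ≤ ((0 : ℝ) : WithBot ℝ)} ∧
    -- bases and dimensions of the Riemann-Roch spaces from semi-reduced bases
    (∀ (n : ℕ) (b : Module.Basis (Fin n) k[X] (FFLattice.finModule D)),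
      FFLattice.IsSemiReduced k (FFLattice.divNorm D) (fun i => (b i : F)) →
      ∀ r : ℤ,
        (LinearIndependent k
          (fun p : {p : Fin n × ℕ //
              (p.2 : ℤ) ≤ r - FFLattice.ceilLength (FFLattice.divNorm D) (b p.1 : F)} =>
            (b p.1.1 : F) * algebraMap (RatFunc k) F RatFunc.X ^ p.1.2)) ∧
        Submodule.span k
          (Set.range (fun p : {p : Fin n × ℕ //
              (p.2 : ℤ) ≤ r - FFLattice.ceilLength (FFLattice.divNorm D) (b p.1 : F)} =>
            (b p.1.1 : F) * algebraMap (RatFunc k) F RatFunc.X ^ p.1.2)) =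
          FFLattice.RRSpace (D + r • FFLattice.poleDivisor k F) ∧
        FiniteDimensional k (FFLattice.RRSpace (D + r • FFLattice.poleDivisor k F)) ∧
        (Module.finrank k (FFLattice.RRSpace (D + r • FFLattice.poleDivisor k F)) : ℤ) =
          ∑ i : Fin n with FFLattice.ceilLength (FFLattice.divNorm D) (b i : F) ≤ r,
            (r - FFLattice.ceilLength (FFLattice.divNorm D) (b i : F) + 1)) := by
  refine ⟨fun r => ⟨?_, ?_⟩, FFLattice.isLattice_finModule D, FFLattice.isNormedSpace_divNorm D,
    ?_, fun n b hb r => ⟨?_, FFLattice.span_monomials D b hb r,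
      FFLattice.finiteDimensional_RRSpace D r, FFLattice.finrank_RRSpace D b hb r⟩⟩
  · ext z
    rw [Set.mem_inter_iff, FFLattice.mem_image_infIdeal_iff]
    exact FFLattice.mem_RRSpace_iff D r
  · ext z
    exact FFLattice.mem_RRSpace_iff D r
  · ext z
    exact FFLattice.mem_infIdeal_iff_divNorm D
  · exact FFLattice.linearIndependent_monomials D b
      (fun i => FFLattice.ceilLength (FFLattice.divNorm D) (b i : F)) r
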